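/- **Theorem (equal entropy covers).** *Setting.* Let $d\ge 1$, let $\mathbf R_d=\mathbb Z[u_1^{\pm1},\dots,u_d^{\pm1}]$, and write $h=\sum_{\mathbf n\in\mathbb Z^d}h_{\mathbf n}u^{\mathbf n}$ and $\tilde h=\sum_{\mathbf n}h_{\mathbf n}u^{-\mathbf n}$. Let $\mathbf P_d$ be the set of sandpile polynomials, i.e. of those $h\in\mathbf R_d$ with $2h_{\mathbf 0}>\sum_{\mathbf j}|h_{\mathbf j}|>0$ and $h_{\mathbf j}\le 0$ for all $\mathbf j\ne\mathbf 0$. For $h\in\mathbf P_d$ let $\Delta_{\mathbf i\mathbf j}=h_{\mathbf i-\mathbf j}$ (toppling at $\mathbf i$ replaces each $v_{\mathbf j}$ by $v_{\mathbf j}-\Delta_{\mathbf j\mathbf i}$), and let the sandpile model $\mathcal R^{(h)}$ be the set of all $v\in\{0,\dots,h_{\mathbf 0}-1\}^{\mathbb Z^d}$ such that for every nonempty finite $E\subset\mathbb Z^d$ there is an $\mathbf i\in E$ with $$v_{\mathbf i}\ \ge\ N_E(\mathbf i):=-\sum_{\mathbf j\in E,\ \mathbf j\neq\mathbf i}\Delta_{\mathbf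 i\mathbf j}.$$ Products are convolutions: $(u\cdot v)_{\mathbf n}=\sum_{\mathbf j}u_{\mathbf j}v_{\mathbf n-\mathbf j}$. When $h\cdot w=\delta_{\mathbf 0}$ has a unique solution $w=w^h\in\ell^1(\mathbb Z^d,\mathbb R)$, put $\xi_h(v)=w^h\cdot v \pmod 1$, a map $\ell^\infty(\mathbb Z^d,\mathbb Z)\to\mathbb T^{\mathbb Z^d}$, $\mathbb T=\mathbb R/\mathbb Z$. Let $$X_h=\Big\{x\in\mathbb T^{\mathbb Z^d}:\ \sum_{\mathbf n}h_{\mathbf n}x_{\mathbf n+\mathbf m}=0\ \text{ for all }\mathbf m\in\mathbb Z^d\Big\},$$ and let $\mathbb Z^d$ act on $\mathbb T^{\mathbb Z^d}$ and on $\mathbb Z^{\mathbb Z^d}$ by the shifts $(\sigma^{\mathbf m}v)_{\mathbf n}=v_{\mathbf m+\mathbf n}$. *Statement.* Let $h=fg\in\mathbf P_d$ with $f,g\in\mathbf R_d$, and suppose that $f$ and $g$ have no common factor (every common divisor of $f$ and $g$ in $\mathbf R_d$ is a unit). Then $w^g$ and $w^h$ exist and are unique, so that $\xi_g$ and $\xi_h$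 are defined, and $$\mathcal W^{(h)}_g:=\mathcal R^{(h)}\cap\ker\xi_g=\{g\cdot u\in\mathcal R^{(h)}:\ u\in\ell^\infty(\mathbb Z^d,\mathbb Z)\}$$ is an equal entropy cover of $X_{\tilde f}$ with covering map $\xi_h$. That is: $\mathcal W^{(h)}_g$ is a compact shift-invariant set (a subshift); $X_{\tilde f}$ is compact and shift-invariant; $\xi_h$ restricted to $\mathcal W^{(h)}_g$ is continuous, commutes with the shifts, and satisfies $\xi_h(\mathcal W^{(h)}_g)=X_{\tilde f}$; and the topological entropies of the shift actions of $\mathbb Z^d$ on $\mathcal W^{(h)}_g$ and on $X_{\tilde f}$ coincide. -/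

import Mathlib

open Topology Uniformity

noncomputable section

namespace Sandpile

/-- The ring `ℤ[u₁^{±1}, …, u_d^{±1}]` of Laurent polynomials in `d` variables; the coefficient
of `u^n` in `h` is `h.coeff n`. -/
abbrev LaurentPoly (d : ℕ) : Type := AddMonoidAlgebra ℤ (Fin d → ℤ)

variable {d : ℕ}

/-! ### Sandpile polynomials and recurrent configurations -/

/-- `h` is lopsided with dominant coefficient at `m`: `2 h_m > ∑_j |h_j| > 0`. -/
def IsLopsidedAt (h : LaurentPoly d) (m : Fin d → ℤ) : Prop :=
  (∑ j ∈ h.coeff.support, |h.coeff j|) < 2 * h.coeff m ∧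
    0 < ∑ j ∈ h.coeff.support, |h.coeff j|

/-- Sandpile polynomials: lopsided, the dominant coefficient is `h_0`, and all other
coefficients are nonpositive. -/
def IsSandpilePoly (h : LaurentPoly d) : Prop :=
  IsLopsidedAt h 0 ∧ ∀ j : Fin d → ℤ, j ≠ 0 → h.coeff j ≤ 0

/-- The (infinite) toppling matrix `Δ_{ij} = h_{i-j}`.  A toppling at `i` replaces `v_j` by
`v_j - Δ_{ji}` for every `j`. -/
def toppling (h : LaurentPoly d) (i j : Fin d → ℤ) : ℤ := h.coeff (i - j)

/-- The number of grains that the site `i` receives when every other site of the finite set `E`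
topples once: `N_E(i) = -∑_{j ∈ E, j ≠ i} Δ_{ij}`. -/
def inflow (h : LaurentPoly d) (E : Finset (Fin d → ℤ)) (i : Fin d → ℤ) : ℤ :=
  -∑ j ∈ E.erase i, toppling h i j

/-- Stable configurations on the lattice: `0 ≤ v_i < γ_h` with `γ_h = h_0`. -/
def stableConfigs (h : LaurentPoly d) : Set ((Fin d → ℤ) → ℤ) :=
  {v | ∀ i, 0 ≤ v i ∧ v i < h.coeff 0}

/-- The abelian sandpile model in infinite volume: stable configurations that pass the burning
test on every nonempty finite set of sites. -/
def recurrentConfigs (h : LaurentPoly d) : Set ((Fin d → ℤ) → ℤ) :=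
  {v | v ∈ stableConfigs h ∧
    ∀ E : Finset (Fin d → ℤ), E.Nonempty → ∃ i ∈ E, inflow h E i ≤ v i}

/-! ### The shift and the algebraic model -/

/-- The shift action of `ℤ^d`: `(σ^m v)_n = v_{m+n}`. -/
def shift {A : Type*} (m : Fin d → ℤ) (v : (Fin d → ℤ) → A) : (Fin d → ℤ) → A :=
  fun n => v (m + n)

/-- `h̃ = ∑_n h_n u^{-n}`. -/
def tilde (h : LaurentPoly d) : LaurentPoly d :=
  AddMonoidAlgebra.domCongr ℤ ℤ (AddEquiv.neg (Fin d → ℤ)) h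

theorem coeff_tilde (h : LaurentPoly d) (n : Fin d → ℤ) :
    (tilde h).coeff n = h.coeff (-n) := by
  simp [tilde]

/-- `X_h = {x ∈ 𝕋^{ℤ^d} : ∑_n h_n x_{n+m} = 0 for all m}`, where `𝕋 = ℝ/ℤ`. -/
def algebraicModel (h : LaurentPoly d) : Set ((Fin d → ℤ) → UnitAddCircle) :=
  {x | ∀ m, ∑ n ∈ h.coeff.support, h.coeff n • x (n + m) = 0}

/-! ### Homoclinic points and the maps `ξ_h` -/

/-- Convolution `(u · v)_n = ∑_j u_j v_{n-j}` of real functions on `ℤ^d`; it is only used when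
one factor is absolutely summable and the other one is bounded. -/
def conv (u v : (Fin d → ℤ) → ℝ) : (Fin d → ℤ) → ℝ :=
  fun n => ∑' j, u j * v (n - j)

/-- `w ∈ ℓ¹(ℤ^d, ℝ)` and `h · w = δ_0`. -/
def IsHomoclinicPoint (h : LaurentPoly d) (w : (Fin d → ℤ) → ℝ) : Prop :=
  (Summable fun n => |w n|) ∧ conv (fun j => (h.coeff j : ℝ)) w = Pi.single 0 1

open Classical in
/-- The solution `w^h ∈ ℓ¹(ℤ^d, ℝ)` of `h · w = δ_0` (and `0` if there is none). -/
def homoclinicPoint (h : LaurentPoly d) : (Fin d → ℤ) → ℝ :=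
  if hw : ∃ w, IsHomoclinicPoint h w then hw.choose else 0

/-- `ℓ^∞(ℤ^d, ℤ)`. -/
def boundedConfigs (d : ℕ) : Set ((Fin d → ℤ) → ℤ) :=
  {v | ∃ C : ℤ, ∀ n, |v n| ≤ C}

/-- `ξ̄_h(v) = w^h · v`. -/
def xiBar (h : LaurentPoly d) (v : (Fin d → ℤ) → ℤ) : (Fin d → ℤ) → ℝ :=
  conv (homoclinicPoint h) fun n => (v n : ℝ)

/-- `ξ_h(v) = w^h · v mod 1`. -/
def xi (h : LaurentPoly d) (v : (Fin d → ℤ) → ℤ) : (Fin d → ℤ) → UnitAddCircle :=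
  fun n => (xiBar h v n : UnitAddCircle)

/-- The kernel of `ξ_g` on `ℓ^∞(ℤ^d, ℤ)`. -/
def kerXi (g : LaurentPoly d) : Set ((Fin d → ℤ) → ℤ) :=
  {v | v ∈ boundedConfigs d ∧ xi g v = 0}

/-- `W_g^{(h)} = R^{(h)} ∩ ker ξ_g`. -/
def multiplesModel (h g : LaurentPoly d) : Set ((Fin d → ℤ) → ℤ) :=
  recurrentConfigs h ∩ kerXi g

/-- The product `g · u` for an integer configuration `u`: `(g · u)_n = ∑_j g_j u_{n-j}`. -/
def polyMul (g : LaurentPoly d) (u : (Fin d → ℤ) → ℤ) : (Fin d → ℤ) → ℤ :=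
  fun n => ∑ j ∈ g.coeff.support, g.coeff j * u (n - j)

/-! ### Topological entropy of `ℤ^d`-actions -/

/-- The box `Q_n = {-n, …, n}^d`. -/
def box (d n : ℕ) : Finset (Fin d → ℤ) :=
  Fintype.piFinset fun _ => Finset.Icc (-(n : ℤ)) n

/-- `Z` is separated in the window `E` at scale `U` under the action `T`: any two distinct points
of `Z` are moved to points that are not `U`-close by some `T^k` with `k ∈ E`. -/
def IsSeparatedIn {X : Type*} (T : (Fin d → ℤ) → X → X) (E : Finset (Fin d → ℤ))
    (U : Set (X × X)) (Z : Set X) : Prop :=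
  Z.Pairwise fun x y => ∃ k ∈ E, (T k x, T k y) ∉ U

/-- The maximal cardinality of a subset of `F` that is separated in the window `E` at
scale `U`. -/
def maxSeparated {X : Type*} (T : (Fin d → ℤ) → X → X) (F : Set X) (E : Finset (Fin d → ℤ))
    (U : Set (X × X)) : ℕ∞ :=
  ⨆ (Z : Finset X) (_ : (Z : Set X) ⊆ F ∧ IsSeparatedIn T E U (Z : Set X)), (Z.card : ℕ∞)

/-- The topological entropy of the restriction of a `ℤ^d`-action `T` to an invariant compact
set `F`: the supremum over entourages `U` of the exponential growth rate, relative to `|Q_n|`, of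
the maximal cardinality of `(Q_n, U)`-separated subsets of `F`. -/
def topEntropy {X : Type*} [UniformSpace X] (T : (Fin d → ℤ) → X → X) (F : Set X) : EReal :=
  ⨆ U ∈ 𝓤 X, Filter.limsup
    (fun n : ℕ => ENNReal.log (maxSeparated T F (box d n) U : ENNReal) /
      ((box d n).card : EReal)) Filter.atTop

/-! ### Covers -/

/-- A subshift: a compact (for the product of the discrete topologies), shift-invariant set of
bounded integer configurations. -/
structure IsSubshift (Y : Set ((Fin d → ℤ) → ℤ)) : Prop where
  bounded : Y ⊆ boundedConfigs d
  isCompact : IsCompact Y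
  invariant : ∀ m : Fin d → ℤ, Set.MapsTo (shift m) Y Y

/-- `T` restricts to a continuous `ℤ^d`-action on the compact set `X`. -/
structure IsCompactSystem {A : Type*} [TopologicalSpace A] (T : (Fin d → ℤ) → A → A)
    (X : Set A) : Prop where
  isCompact : IsCompact X
  mapsTo : ∀ m, Set.MapsTo (T m) X X
  continuousOn : ∀ m, ContinuousOn (T m) X
  map_zero : ∀ x ∈ X, T 0 x = x
  map_add : ∀ m n, ∀ x ∈ X, T (m + n) x = T m (T n x)

/-- The subshift `Y` is a symbolic cover of `(X, T)` with covering map `φ`: the map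
`φ : Y → X` is continuous, surjective and equivariant. -/
structure IsSymbolicCover {A : Type*} [TopologicalSpace A] (Y : Set ((Fin d → ℤ) → ℤ))
    (T : (Fin d → ℤ) → A → A) (X : Set A) (φ : ((Fin d → ℤ) → ℤ) → A) : Prop where
  subshift : IsSubshift Y
  system : IsCompactSystem T X
  continuousOn : ContinuousOn φ Y
  image_eq : φ '' Y = X
  equivariant : ∀ m, ∀ v ∈ Y, φ (shift m v) = T m (φ v)

/-- A symbolic cover with the same topological entropy. -/
structure IsEqualEntropyCover {A : Type*} [UniformSpace A] (Y : Set ((Fin d → ℤ) → ℤ))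
    (T : (Fin d → ℤ) → A → A) (X : Set A) (φ : ((Fin d → ℤ) → ℤ) → A) : Prop
    extends IsSymbolicCover Y T X φ where
  entropy_eq : topEntropy (shift (d := d) (A := ℤ)) Y = topEntropy T X

end Sandpile

end

open Sandpile

/-! Diagonal dominance makes `h` invertible in ℓ¹ by a Neumann series, and then `f · w^h` inverts
`g`. Hence the kernel of `ξ_g` consists of the bounded multiples of `g`. For such a multiple `g ·
u`, `f · (w^h · g · u) = u` is integral, so `ξ_h` lands in the kernel of `f` on the torus, which is
`X_{f̃}`.

Surjectivity: lift a point of `X_{f̃}` to a bounded real `y`. Then `u = f · y` is integral and `g ·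
u = h · y`, so `w^h · g · u = y`. Adding a suitable `h · z` makes `g · u` recurrent
(`exists_add_act_mem_recurrentConfigs`). It stays a multiple of `g`, and `w^h · g · u` changes only
by the integer configuration `z`.

Entropy does not increase under the factor map `ξ_h`. It does not drop either, because `ξ_h` is
injective up to boundary data (`eq_on_box_of_recurrent`): if the images of two recurrent
configurations are close on `Q_n`, the real lifts differ there by almost an integer configuration
`z`. When `z` vanishes near the boundary, the difference of the two configurations equals `h · z`
inside, and the burning test forces `z = 0` (`eq_zero_of_recurrent`). So each small ball in `X_{f̃}`
accounts for a number of configurations at most exponential in the size of an annulus, which is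
`o(|Q_n|)`. -/

noncomputable section

namespace Sandpile

variable {d : ℕ}

/-! ### Laurent polynomials acting on configurations by convolution -/

/-- The translation representation of `ℤ^d` on configurations. -/
def translationRep (d : ℕ) (M : Type*) [AddCommGroup M] :
    Multiplicative (Fin d → ℤ) →* Module.End ℤ ((Fin d → ℤ) → M) where
  toFun a := LinearMap.funLeft ℤ M fun n => n - a.toAdd
  map_one' := by ext x n; simp [LinearMap.funLeft_apply]
  map_mul' a b := by
    refine LinearMap.ext fun x => funext fun n => ?_
    simp [LinearMap.funLeft_apply, sub_sub]

/-- The action of Laurent polynomials on configurations by convolution. -/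
def act (M : Type*) [AddCommGroup M] :
    LaurentPoly d →ₐ[ℤ] Module.End ℤ ((Fin d → ℤ) → M) :=
  AddMonoidAlgebra.lift ℤ _ _ (translationRep d M)

theorem act_apply {M : Type*} [AddCommGroup M] (h : LaurentPoly d) (x : (Fin d → ℤ) → M)
    (n : Fin d → ℤ) :
    act M h x n = ∑ j ∈ h.coeff.support, h.coeff j • x (n - j) := by
  rw [act, AddMonoidAlgebra.lift_apply, Finsupp.sum]
  simp [translationRep, LinearMap.funLeft_apply]

theorem act_mul_apply {M : Type*} [AddCommGroup M] (f g : LaurentPoly d)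
    (x : (Fin d → ℤ) → M) : act M (f * g) x = act M f (act M g x) := by
  rw [map_mul]; rfl

theorem polyMul_eq_act (g : LaurentPoly d) (u : (Fin d → ℤ) → ℤ) : polyMul g u = act ℤ g u := by
  funext n; simp [polyMul, act_apply]

theorem act_intCast (g : LaurentPoly d) (u : (Fin d → ℤ) → ℤ) :
    act ℝ g (fun n => (u n : ℝ)) = fun n => ((act ℤ g u n : ℤ) : ℝ) := by
  funext n; simp [act_apply]

theorem act_shift {M : Type*} [AddCommGroup M] (g : LaurentPoly d) (m : Fin d → ℤ)
    (x : (Fin d → ℤ) → M) : act M g (shift m x) = shift m (act M g x) := by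
  funext n; simp [act_apply, shift, add_sub_assoc]

theorem conv_coeff (h : LaurentPoly d) (x : (Fin d → ℤ) → ℝ) :
    conv (fun j => (h.coeff j : ℝ)) x = act ℝ h x := by
  funext n
  rw [act_apply, conv, tsum_eq_sum (s := h.coeff.support)]
  · simp
  · intro b hb; simp [Finsupp.notMem_support_iff.mp hb]

/-- Bounded real configurations. -/
def IsBdd (x : (Fin d → ℤ) → ℝ) : Prop := ∃ C, ∀ n, |x n| ≤ C

theorem IsBdd.act {x : (Fin d → ℤ) → ℝ} (hx : IsBdd x) (g : LaurentPoly d) :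
    IsBdd (act ℝ g x) := by
  obtain ⟨C, hC⟩ := hx
  refine ⟨∑ j ∈ g.coeff.support, |(g.coeff j : ℝ)| * C, fun n => ?_⟩
  rw [act_apply]
  refine (Finset.abs_sum_le_sum_abs _ _).trans (Finset.sum_le_sum fun j _ => ?_)
  rw [zsmul_eq_mul, abs_mul]
  exact mul_le_mul_of_nonneg_left (hC _) (abs_nonneg _)

theorem isBdd_intCast {u : (Fin d → ℤ) → ℤ} :
    IsBdd (fun n => (u n : ℝ)) ↔ u ∈ boundedConfigs d := by
  constructor
  · rintro ⟨C, hC⟩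
    refine ⟨⌈C⌉, fun n => ?_⟩
    have : |(u n : ℝ)| ≤ (⌈C⌉ : ℤ) := (hC n).trans (Int.le_ceil C)
    exact_mod_cast this
  · rintro ⟨C, hC⟩
    exact ⟨C, fun n => show |(u n : ℝ)| ≤ C by exact_mod_cast hC n⟩

theorem IsBdd.intAct {u : (Fin d → ℤ) → ℤ} (hu : u ∈ boundedConfigs d) (g : LaurentPoly d) :
    Sandpile.act ℤ g u ∈ boundedConfigs d := by
  rw [← isBdd_intCast, ← act_intCast]
  exact (isBdd_intCast.2 hu).act g

theorem isBdd_of_summable {w : (Fin d → ℤ) → ℝ} (hw : Summable fun n => |w n|) : IsBdd w :=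
  ⟨∑' n, |w n|, fun n => hw.le_tsum n fun _ _ => abs_nonneg _⟩

theorem conv_term_le {x : (Fin d → ℤ) → ℝ} {C : ℝ} (w : (Fin d → ℤ) → ℝ) (hC : ∀ n, |x n| ≤ C)
    (n j : Fin d → ℤ) : |w j * x (n - j)| ≤ |w j| * C := by
  rw [abs_mul]
  exact mul_le_mul_of_nonneg_left (hC _) (abs_nonneg _)

theorem summable_conv {w x : (Fin d → ℤ) → ℝ} (hw : Summable fun n => |w n|) (hx : IsBdd x)
    (n : Fin d → ℤ) : Summable fun j => w j * x (n - j) := by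
  obtain ⟨C, hC⟩ := hx
  exact Summable.of_norm_bounded (hw.mul_right C) fun j => conv_term_le w hC n j

theorem abs_conv_le {w x : (Fin d → ℤ) → ℝ} (hw : Summable fun n => |w n|) {C : ℝ}
    (hC : ∀ n, |x n| ≤ C) (n : Fin d → ℤ) : |conv w x n| ≤ (∑' j, |w j|) * C := by
  rw [← tsum_mul_right, ← Real.norm_eq_abs]
  exact tsum_of_norm_bounded (hw.mul_right C).hasSum (f := fun j => w j * x (n - j))
    fun j => conv_term_le w hC n j

theorem IsBdd.conv {w x : (Fin d → ℤ) → ℝ} (hw : Summable fun n => |w n|) (hx : IsBdd x) :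
    IsBdd (conv w x) := by
  obtain ⟨C, hC⟩ := hx
  exact ⟨_, abs_conv_le hw hC⟩

theorem conv_add {w x y : (Fin d → ℤ) → ℝ} (hw : Summable fun n => |w n|) (hx : IsBdd x)
    (hy : IsBdd y) : conv w (x + y) = conv w x + conv w y := by
  funext n
  simp only [Sandpile.conv, Pi.add_apply, mul_add]
  exact (summable_conv hw hx n).tsum_add (summable_conv hw hy n)

theorem conv_act {w x : (Fin d → ℤ) → ℝ} (hw : Summable fun n => |w n|) (hx : IsBdd x)
    (g : LaurentPoly d) : conv w (act ℝ g x) = act ℝ g (conv w x) := by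
  funext n
  simp only [act_apply, Sandpile.conv, Finset.mul_sum, zsmul_eq_mul]
  rw [Summable.tsum_finsetSum]
  · refine Finset.sum_congr rfl fun k _ => ?_
    rw [← tsum_mul_left]
    refine tsum_congr fun j => ?_
    rw [sub_right_comm]; ring
  · intro k _
    refine ((summable_conv hw hx (n - k)).mul_left (g.coeff k : ℝ)).congr fun j => ?_
    rw [sub_right_comm]; ring

theorem act_conv {w x : (Fin d → ℤ) → ℝ} (hw : Summable fun n => |w n|) (hx : IsBdd x)
    (g : LaurentPoly d) : conv (act ℝ g w) x = act ℝ g (conv w x) := by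
  funext n
  have key : ∀ k j : Fin d → ℤ, (g.coeff k : ℝ) * w (j - k) * x (n - j) =
      (g.coeff k : ℝ) * (w ((Equiv.subRight k) j) * x (n - k - (Equiv.subRight k) j)) := by
    intro k j
    rw [Equiv.subRight_apply, sub_sub_sub_cancel_right, mul_assoc]
  simp only [act_apply, Sandpile.conv, Finset.sum_mul, zsmul_eq_mul]
  have hs : ∀ k, Summable fun j =>
      w ((Equiv.subRight k) j) * x (n - k - (Equiv.subRight k) j) := fun k =>
    (Equiv.subRight k).summable_iff.2 (summable_conv hw hx (n - k))
  rw [Summable.tsum_finsetSum]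
  · refine Finset.sum_congr rfl fun k _ => ?_
    simp only [key]
    rw [tsum_mul_left,
      (Equiv.subRight k).tsum_eq (fun j => w j * x (n - k - j))]
  · intro k _
    simp only [key]
    exact (hs k).mul_left _

theorem conv_single_one (x : (Fin d → ℤ) → ℝ) : conv (Pi.single 0 1) x = x := by
  funext n
  rw [Sandpile.conv, tsum_eq_single 0]
  · simp
  · intro j hj; simp [hj]

theorem summable_act {w : (Fin d → ℤ) → ℝ} (hw : Summable fun n => |w n|) (f : LaurentPoly d) :
    Summable fun n => |act ℝ f w n| := by
  refine Summable.abs ?_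
  have : act ℝ f w = fun n => ∑ k ∈ f.coeff.support, f.coeff k • w (n - k) :=
    funext fun n => act_apply f w n
  rw [this]
  refine summable_sum fun k _ => ?_
  exact ((Equiv.subRight k).summable_iff.2 hw.of_abs).const_smul (f.coeff k)

theorem isHomoclinicPoint_iff {h : LaurentPoly d} {w : (Fin d → ℤ) → ℝ} :
    IsHomoclinicPoint h w ↔ (Summable fun n => |w n|) ∧ act ℝ h w = Pi.single 0 1 := by
  rw [IsHomoclinicPoint, conv_coeff]

theorem IsHomoclinicPoint.act_conv {h : LaurentPoly d} {w x : (Fin d → ℤ) → ℝ}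
    (hw : IsHomoclinicPoint h w) (hx : IsBdd x) : act ℝ h (conv w x) = x := by
  rw [isHomoclinicPoint_iff] at hw
  rw [← Sandpile.act_conv hw.1 hx, hw.2, conv_single_one]

theorem IsHomoclinicPoint.conv_act {h : LaurentPoly d} {w x : (Fin d → ℤ) → ℝ}
    (hw : IsHomoclinicPoint h w) (hx : IsBdd x) : conv w (act ℝ h x) = x := by
  rw [Sandpile.conv_act hw.1 hx, hw.act_conv hx]

theorem IsHomoclinicPoint.unique {h : LaurentPoly d} {w w' : (Fin d → ℤ) → ℝ}
    (hw : IsHomoclinicPoint h w) (hw' : IsHomoclinicPoint h w') : w' = w := by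
  rw [← hw.conv_act (isBdd_of_summable hw'.1), (isHomoclinicPoint_iff.1 hw').2,
    ← (isHomoclinicPoint_iff.1 hw).2, hw.conv_act (isBdd_of_summable hw.1)]

theorem IsHomoclinicPoint.of_mul {f g : LaurentPoly d} {w : (Fin d → ℤ) → ℝ}
    (hw : IsHomoclinicPoint (f * g) w) : IsHomoclinicPoint g (act ℝ f w) := by
  rw [isHomoclinicPoint_iff] at hw ⊢
  exact ⟨summable_act hw.1 f, by rw [← act_mul_apply, mul_comm, hw.2]⟩

theorem isHomoclinicPoint_homoclinicPoint {h : LaurentPoly d}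
    (hw : ∃ w, IsHomoclinicPoint h w) : IsHomoclinicPoint h (homoclinicPoint h) := by
  rw [homoclinicPoint, dif_pos hw]
  exact hw.choose_spec

/-! ### Sandpile polynomials -/

theorem IsSandpilePoly.coeff_zero_pos {h : LaurentPoly d} (hh : IsSandpilePoly h) :
    0 < h.coeff 0 := by
  have := hh.1.1
  have := hh.1.2
  omega

theorem IsSandpilePoly.zero_mem_support {h : LaurentPoly d} (hh : IsSandpilePoly h) :
    (0 : Fin d → ℤ) ∈ h.coeff.support :=
  Finsupp.mem_support_iff.2 hh.coeff_zero_pos.ne'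

theorem IsSandpilePoly.sum_erase_lt {h : LaurentPoly d} (hh : IsSandpilePoly h) :
    ∑ j ∈ h.coeff.support.erase 0, -h.coeff j < h.coeff 0 := by
  have h1 := hh.1.1
  rw [← Finset.add_sum_erase _ _ hh.zero_mem_support, abs_of_pos hh.coeff_zero_pos] at h1
  have : ∑ j ∈ h.coeff.support.erase 0, |h.coeff j| =
      ∑ j ∈ h.coeff.support.erase 0, -h.coeff j :=
    Finset.sum_congr rfl fun j hj => abs_of_nonpos (hh.2 j (Finset.ne_of_mem_erase hj))
  omega

theorem IsSandpilePoly.sum_pos {h : LaurentPoly d} (hh : IsSandpilePoly h) :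
    0 < ∑ j ∈ h.coeff.support, h.coeff j := by
  have h1 := hh.sum_erase_lt
  rw [Finset.sum_neg_distrib] at h1
  rw [← Finset.add_sum_erase _ _ hh.zero_mem_support]
  omega

theorem IsSandpilePoly.act_eq {h : LaurentPoly d} (hh : IsSandpilePoly h)
    {M : Type*} [AddCommGroup M] (x : (Fin d → ℤ) → M) (n : Fin d → ℤ) :
    act M h x n = h.coeff 0 • x n + ∑ j ∈ h.coeff.support.erase 0, h.coeff j • x (n - j) := by
  rw [act_apply, ← Finset.add_sum_erase _ _ hh.zero_mem_support, sub_zero]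

/-- The terms of the Neumann series for the inverse of `h`. -/
def neumannTerm (h : LaurentPoly d) : ℕ → (Fin d → ℤ) → ℝ
  | 0 => Pi.single 0 ((h.coeff 0 : ℝ)⁻¹)
  | n + 1 => fun k => ∑ j ∈ h.coeff.support.erase 0,
      (-(h.coeff j : ℝ) / h.coeff 0) * neumannTerm h n (k - j)

theorem IsSandpilePoly.neumannTerm_nonneg {h : LaurentPoly d} (hh : IsSandpilePoly h) (n : ℕ)
    (k : Fin d → ℤ) : 0 ≤ neumannTerm h n k := by
  have h0 : (0 : ℝ) < h.coeff 0 := by exact_mod_cast hh.coeff_zero_pos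
  induction n generalizing k with
  | zero =>
    rw [neumannTerm, Pi.single_apply]
    split_ifs <;> positivity
  | succ n ih =>
    refine Finset.sum_nonneg fun j hj => mul_nonneg (div_nonneg ?_ h0.le) (ih _)
    have := hh.2 j (Finset.ne_of_mem_erase hj)
    exact_mod_cast neg_nonneg.2 this

theorem hasSum_neumannTerm (h : LaurentPoly d) (n : ℕ) :
    HasSum (neumannTerm h n) ((∑ j ∈ h.coeff.support.erase 0,
      (-(h.coeff j : ℝ) / h.coeff 0)) ^ n * (h.coeff 0 : ℝ)⁻¹) := by
  induction n with
  | zero => simpa [neumannTerm] using hasSum_pi_single (0 : Fin d → ℤ) ((h.coeff 0 : ℝ)⁻¹)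
  | succ n ih =>
    rw [pow_succ', mul_assoc, Finset.sum_mul]
    refine hasSum_sum fun j _ => HasSum.mul_left _ ?_
    exact (Equiv.subRight j).hasSum_iff.2 ih

theorem IsSandpilePoly.exists_isHomoclinicPoint {h : LaurentPoly d} (hh : IsSandpilePoly h) :
    ∃ w, IsHomoclinicPoint h w := by
  have h0 : (0 : ℝ) < h.coeff 0 := by exact_mod_cast hh.coeff_zero_pos
  set θ : ℝ := ∑ j ∈ h.coeff.support.erase 0, (-(h.coeff j : ℝ) / h.coeff 0) with hθ
  have hθ0 : 0 ≤ θ := Finset.sum_nonneg fun j hj => div_nonneg (by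
    exact_mod_cast neg_nonneg.2 (hh.2 j (Finset.ne_of_mem_erase hj))) h0.le
  have hθ1 : θ < 1 := by
    rw [hθ, ← Finset.sum_div, div_lt_one h0]
    exact_mod_cast hh.sum_erase_lt
  -- All terms are nonnegative, so the geometric bound on the total masses (ratio `θ < 1`) gives
  -- joint summability, hence summability in either order.
  have hpair : Summable fun p : (Fin d → ℤ) × ℕ => neumannTerm h p.2 p.1 := by
    have : Summable fun p : ℕ × (Fin d → ℤ) => neumannTerm h p.1 p.2 := by
      rw [summable_prod_of_nonneg fun p => hh.neumannTerm_nonneg _ _]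
      refine ⟨fun n => (hasSum_neumannTerm h n).summable, ?_⟩
      simp only [(hasSum_neumannTerm h _).tsum_eq]
      exact (summable_geometric_of_lt_one hθ0 hθ1).mul_right _
    exact (Equiv.prodComm _ _).summable_iff.2 this
  have hfib : ∀ k, Summable fun n => neumannTerm h n k := fun k => hpair.prod_factor k
  refine ⟨fun k => ∑' n, neumannTerm h n k, isHomoclinicPoint_iff.2 ⟨?_, ?_⟩⟩
  · exact hpair.prod.abs
  · funext k
    rw [hh.act_eq, (hfib k).tsum_eq_zero_add]
    -- Telescoping: shifting the series by one index reproduces the off-diagonal part of `h`,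
    -- leaving only the term of index 0.
    have : ∑' n, neumannTerm h (n + 1) k = ∑ j ∈ h.coeff.support.erase 0,
        (-(h.coeff j : ℝ) / h.coeff 0) * ∑' n, neumannTerm h n (k - j) := by
      simp only [neumannTerm]
      rw [Summable.tsum_finsetSum fun j _ => (hfib _).mul_left _]
      simp only [tsum_mul_left]
    rw [this]
    simp only [zsmul_eq_mul, neumannTerm, mul_add, Finset.mul_sum]
    rw [add_assoc, ← Finset.sum_add_distrib, Finset.sum_eq_zero, add_zero]
    · by_cases hk : k = 0
      · subst hk; simp [h0.ne']
      · simp [hk]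
    · intro j _
      field_simp
      ring

/-! ### Recurrent configurations modulo multiples of `h` -/

theorem toppling_sum_eq {h : LaurentPoly d} {E : Finset (Fin d → ℤ)} {i : Fin d → ℤ}
    (hi : i ∈ E) : ∑ j ∈ E, toppling h i j = h.coeff 0 - inflow h E i := by
  rw [← Finset.add_sum_erase _ _ hi, inflow, toppling, sub_self]
  ring

/-- The burning test on a singleton is nonnegativity, so only the upper stability bound is needed
separately. The sum over `E` is `(h · χ_E)_i`, the form in which the test interacts with multiples
of `h`. -/
theorem mem_recurrentConfigs_iff {h : LaurentPoly d} {v : (Fin d → ℤ) → ℤ} :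
    v ∈ recurrentConfigs h ↔ (∀ i, v i < h.coeff 0) ∧
      ∀ E : Finset (Fin d → ℤ), E.Nonempty →
        ∃ i ∈ E, h.coeff 0 - v i ≤ ∑ j ∈ E, toppling h i j := by
  constructor
  · rintro ⟨hv, hE⟩
    refine ⟨fun i => (hv i).2, fun E hne => ?_⟩
    obtain ⟨i, hi, hle⟩ := hE E hne
    exact ⟨i, hi, by rw [toppling_sum_eq hi]; omega⟩
  · rintro ⟨hv, hE⟩
    refine ⟨fun i => ⟨?_, hv i⟩, fun E hne => ?_⟩
    · obtain ⟨j, hj, hle⟩ := hE {i} (Finset.singleton_nonempty i)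
      rw [Finset.mem_singleton] at hj
      subst hj
      simp only [Finset.sum_singleton, toppling, sub_self] at hle
      omega
    · obtain ⟨i, hi, hle⟩ := hE E hne
      rw [toppling_sum_eq hi] at hle
      exact ⟨i, hi, by omega⟩

theorem act_indicator (h : LaurentPoly d) (E : Finset (Fin d → ℤ)) (i : Fin d → ℤ) :
    act ℤ h (fun n => if n ∈ E then 1 else 0) i = ∑ j ∈ E, toppling h i j := by
  rw [act_apply]
  simp only [smul_eq_mul, mul_ite, mul_one, mul_zero, toppling]
  rw [← Finset.sum_filter]
  refine Finset.sum_bij_ne_zero (fun j _ _ => i - j) ?_ ?_ ?_ ?_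
  · intro j hj _
    exact (Finset.mem_filter.1 hj).2
  · intro j _ _ k _ _ hjk
    exact sub_right_injective hjk
  · intro j hj hne
    refine ⟨i - j, ?_, hne, sub_sub_cancel i j⟩
    simpa [hj] using hne
  · intro j _ _
    rw [sub_sub_cancel]

theorem act_const (h : LaurentPoly d) (m : ℤ) (i : Fin d → ℤ) :
    act ℤ h (fun _ => m) i = (∑ j ∈ h.coeff.support, h.coeff j) * m := by
  simp [act_apply, Finset.sum_mul]

/-- The action of a sandpile polynomial is antitone in the values at the other sites. -/
theorem IsSandpilePoly.act_le_act {h : LaurentPoly d} (hh : IsSandpilePoly h)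
    {x y : (Fin d → ℤ) → ℤ} (hxy : x ≤ y) {i : Fin d → ℤ} (hi : x i = y i) :
    act ℤ h y i ≤ act ℤ h x i := by
  rw [hh.act_eq, hh.act_eq, hi]
  refine add_le_add_right (Finset.sum_le_sum fun j hj => ?_) _
  exact mul_le_mul_of_nonpos_left (hxy _) (hh.2 j (Finset.ne_of_mem_erase hj))

/-- Maximum principle: at a site where `z` attains its maximum `m`, `(h · z)` is at least `m ∑ h_j`,
and the integer `∑ h_j` is at least 1. -/
theorem le_of_act_le {h : LaurentPoly d} (hh : IsSandpilePoly h) {z : (Fin d → ℤ) → ℤ}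
    (hz : z ∈ boundedConfigs d) {C : ℤ} (hC : 0 ≤ C) (hle : ∀ i, act ℤ h z i ≤ C)
    (i : Fin d → ℤ) : z i ≤ C := by
  obtain ⟨B, hB⟩ := hz
  obtain ⟨m, ⟨k, hk⟩, hm⟩ := Int.exists_greatest_of_bdd (P := fun m => ∃ k, z k = m)
    ⟨B, by rintro _ ⟨k, rfl⟩; exact (abs_le.1 (hB k)).2⟩ ⟨_, 0, rfl⟩
  refine (hm _ ⟨i, rfl⟩).trans ?_
  by_contra! hlt
  have h1 := hh.act_le_act (x := z) (y := fun _ => m) (fun j => hm _ ⟨j, rfl⟩) (i := k) hk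
  rw [act_const] at h1
  have h2 := hh.sum_pos
  have h3 := hle k
  nlinarith

/-- Every bounded configuration is equivalent to a recurrent one modulo multiples of `h`. -/
theorem exists_add_act_mem_recurrentConfigs {h : LaurentPoly d} (hh : IsSandpilePoly h)
    {v : (Fin d → ℤ) → ℤ} (hv : v ∈ boundedConfigs d) :
    ∃ z ∈ boundedConfigs d, v + act ℤ h z ∈ recurrentConfigs h := by
  obtain ⟨B, hB⟩ := hv
  obtain ⟨c, hc⟩ : ∃ c : (Fin d → ℤ) → ℤ, ∀ i, c i = h.coeff 0 - 1 - v i := ⟨_, fun _ => rfl⟩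
  have h0 := hh.coeff_zero_pos
  have hB0 : 0 ≤ B := (abs_nonneg _).trans (hB 0)
  set C : ℤ := h.coeff 0 + B with hCdef
  have hcl : ∀ i, -C ≤ c i := fun i => by
    have := abs_le.1 (hB i); have := hc i; omega
  have hcu : ∀ i, c i ≤ C := fun i => by
    have := abs_le.1 (hB i); have := hc i; omega
  -- `z ∈ S` says that `v + h · z` is at most `h_0 - 1` everywhere. The required `z` is the greatest
  -- element of `S`.
  set S : Set ((Fin d → ℤ) → ℤ) := {z | z ∈ boundedConfigs d ∧ ∀ i, act ℤ h z i ≤ c i} with hS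
  have hmem : (fun _ => -C) ∈ S := by
    refine ⟨⟨C, fun _ => by rw [abs_neg, abs_of_nonneg (by omega)]⟩, fun i => ?_⟩
    rw [act_const]
    have := hh.sum_pos
    have := hcl i
    nlinarith
  have hub : ∀ z ∈ S, ∀ i, z i ≤ C := fun z hz =>
    le_of_act_le hh hz.1 (by omega) fun i => (hz.2 i).trans (hcu i)
  have hex : ∀ i, ∃ y ∈ S, ∀ z ∈ S, z i ≤ y i := by
    intro i
    obtain ⟨m, ⟨y, hy, rfl⟩, hm⟩ := Int.exists_greatest_of_bdd (P := fun m => ∃ z ∈ S, z i = m)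
      ⟨C, by rintro _ ⟨z, hz, rfl⟩; exact hub z hz i⟩ ⟨_, _, hmem, rfl⟩
    exact ⟨y, hy, fun z hz => hm _ ⟨z, hz, rfl⟩⟩
  choose y hy hmax using hex
  obtain ⟨z, hz⟩ : ∃ z : (Fin d → ℤ) → ℤ, ∀ i, z i = y i i := ⟨_, fun _ => rfl⟩
  have hzb : z ∈ boundedConfigs d := by
    refine ⟨C, fun i => abs_le.2 ⟨?_, ?_⟩⟩
    · rw [hz]; exact hmax i _ hmem
    · rw [hz]; exact hub _ (hy i) i
  -- `S` is stable under pointwise maxima: `z` agrees with `y i` at `i` and dominates it elsewhere,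
  -- which can only lower the value of `h · z` at `i`.
  have hzc : ∀ i, act ℤ h z i ≤ c i := fun i =>
    (hh.act_le_act (x := y i) (fun j => by rw [hz]; exact hmax j _ (hy i)) (hz i).symm).trans
      ((hy i).2 i)
  refine ⟨z, hzb, mem_recurrentConfigs_iff.2 ⟨fun i => ?_, fun E hE => ?_⟩⟩
  · have := hzc i
    have := hc i
    simp only [Pi.add_apply]
    omega
  -- If the burning test failed on `E`, adding the indicator of `E` would stay in `S`: on `E` by the
  -- failure, off `E` because `h · χ_E ≤ 0` there. This contradicts maximality.
  · by_contra! hcon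
    obtain ⟨k, hk⟩ := hE
    obtain ⟨χ, hχ⟩ : ∃ χ : (Fin d → ℤ) → ℤ, χ = fun n => if n ∈ E then 1 else 0 := ⟨_, rfl⟩
    have hact : ∀ i, act ℤ h χ i = ∑ j ∈ E, toppling h i j := fun i => by
      rw [hχ, act_indicator]
    have hzχ : z + χ ∈ S := by
      refine ⟨?_, fun i => ?_⟩
      · obtain ⟨D, hD⟩ := hzb
        refine ⟨D + 1, fun n => (abs_add_le _ _).trans (add_le_add (hD n) ?_)⟩
        rw [hχ]
        dsimp only
        split_ifs <;> simp
      · rw [map_add, Pi.add_apply, hact]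
        by_cases hi : i ∈ E
        · have h1 := hcon i hi
          have h2 := hc i
          simp only [Pi.add_apply] at h1
          omega
        · have : ∑ j ∈ E, toppling h i j ≤ 0 := Finset.sum_nonpos fun j hj =>
            hh.2 _ (sub_ne_zero.2 fun hij => hi (hij ▸ hj))
          have := hzc i
          omega
    have := hmax k _ hzχ
    rw [← hz, Pi.add_apply, hχ] at this
    simp [hk] at this

/-- Suppose the maximum `m` of `z` is positive and test `v'` on the set `E` where it is attained.
Since `z ≤ (m - 1) + χ_E` with equality on `E`, at the site `i` supplied by the test `(h · z)_i ≥ (h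
· χ_E)_i ≥ h_0 - v'_i`. Then `v_i ≥ h_0`, contradicting stability. -/
theorem nonpos_of_recurrent {h : LaurentPoly d} (hh : IsSandpilePoly h)
    {v v' z : (Fin d → ℤ) → ℤ} (hv : v ∈ recurrentConfigs h) (hv' : v' ∈ recurrentConfigs h)
    (hz : z.support.Finite) (hvz : ∀ i, z i ≠ 0 → v i - v' i = act ℤ h z i) : z ≤ 0 := by
  intro n
  by_contra! hn
  simp only [Pi.zero_apply] at hn
  obtain ⟨k, hk, hmax⟩ := Finset.exists_max_image hz.toFinset z ⟨n, by simpa using hn.ne'⟩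
  have hkpos : 0 < z k := hn.trans_le (hmax n (by simpa using hn.ne'))
  have hle : ∀ i, z i ≤ z k := fun i => by
    by_cases hi : z i = 0
    · omega
    · exact hmax i (by simpa using hi)
  set E := hz.toFinset.filter fun i => z i = z k with hE
  obtain ⟨i, hi, hlt⟩ := (mem_recurrentConfigs_iff.1 hv').2 E ⟨k, Finset.mem_filter.2 ⟨hk, rfl⟩⟩
  have hiE : z i = z k := (Finset.mem_filter.1 hi).2
  have h1 := hvz i (by omega)
  have h2 := hh.act_le_act (x := z) (y := (fun _ => z k - 1) +
    fun n => if n ∈ E then 1 else 0) (i := i) (fun j => by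
      by_cases hj : j ∈ E
      · simp [hj, hle j]
      · have : z j ≠ z k := fun hjk => hj (Finset.mem_filter.2
          ⟨by simpa using (show z j ≠ 0 by omega), hjk⟩)
        have := hle j
        simp only [Pi.add_apply, if_neg hj]
        omega) (by simp [hi, hiE])
  rw [map_add, Pi.add_apply, act_indicator, act_const] at h2
  have h3 := hh.sum_pos
  have h4 : 0 ≤ (∑ j ∈ h.coeff.support, h.coeff j) * (z k - 1) :=
    mul_nonneg h3.le (by omega)
  have h5 := (mem_recurrentConfigs_iff.1 hv).1 i
  omega

/-- Recurrent configurations that differ by a finitely supported multiple of `h` near its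
support have trivial difference. -/
theorem eq_zero_of_recurrent {h : LaurentPoly d} (hh : IsSandpilePoly h)
    {v v' z : (Fin d → ℤ) → ℤ} (hv : v ∈ recurrentConfigs h) (hv' : v' ∈ recurrentConfigs h)
    (hz : z.support.Finite) (hvz : ∀ i, z i ≠ 0 → v i - v' i = act ℤ h z i) : z = 0 := by
  refine le_antisymm (nonpos_of_recurrent hh hv hv' hz hvz) ?_
  rw [← neg_nonpos]
  refine nonpos_of_recurrent hh hv' hv (by simpa using hz) fun i hi => ?_
  rw [map_neg, Pi.neg_apply, ← hvz i (by simpa using hi)]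
  ring

/-! ### The algebraic model -/

/-- Reflecting the summation index turns the correlation that defines `X_{f̃}` into convolution by
`f`. -/
theorem mem_algebraicModel_tilde {f : LaurentPoly d} {x : (Fin d → ℤ) → UnitAddCircle} :
    x ∈ algebraicModel (tilde f) ↔ act UnitAddCircle f x = 0 := by
  rw [funext_iff, algebraicModel, Set.mem_ofPred_eq]
  refine forall_congr' fun m => ?_
  rw [act_apply, Pi.zero_apply]
  have : ∑ n ∈ (tilde f).coeff.support, (tilde f).coeff n • x (n + m) =
      ∑ j ∈ f.coeff.support, f.coeff j • x (m - j) := by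
    refine Finset.sum_nbij' (fun n => -n) (fun n => -n) ?_ ?_ ?_ ?_ ?_
    · intro n hn
      simpa [coeff_tilde] using hn
    · intro n hn
      simpa [coeff_tilde] using hn
    · intro n _; simp
    · intro n _; simp
    · intro n _
      rw [coeff_tilde, sub_neg_eq_add, add_comm]
  rw [this]

theorem isClosed_algebraicModel (h : LaurentPoly d) : IsClosed (algebraicModel h) := by
  rw [algebraicModel, Set.ofPred_forall]
  refine isClosed_iInter fun m => isClosed_eq ?_ continuous_const
  exact continuous_finsetSum _ fun n _ => (continuous_zsmul _).comp (continuous_apply _)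

theorem continuous_shift {A : Type*} [TopologicalSpace A] (m : Fin d → ℤ) :
    Continuous (shift (A := A) m) :=
  continuous_pi fun _ => continuous_apply _

theorem shift_add {A : Type*} (m n : Fin d → ℤ) (x : (Fin d → ℤ) → A) :
    shift (m + n) x = shift m (shift n x) := by
  funext k
  simp only [shift]
  congr 1
  abel

theorem isCompactSystem_algebraicModel (f : LaurentPoly d) :
    IsCompactSystem (shift (A := UnitAddCircle)) (algebraicModel (tilde f)) where
  isCompact := (isClosed_algebraicModel _).isCompact
  mapsTo m x hx := by
    rw [mem_algebraicModel_tilde] at hx ⊢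
    rw [act_shift, hx]
    rfl
  continuousOn m := (continuous_shift m).continuousOn
  map_zero x _ := by funext n; simp [shift]
  map_add m n x _ := shift_add m n x

/-! ### The set of recurrent multiples of `g` -/

theorem isCompact_stableConfigs (h : LaurentPoly d) : IsCompact (stableConfigs h) := by
  have : stableConfigs h = Set.univ.pi fun _ => Set.Ico 0 (h.coeff 0) := by
    ext v; simp [stableConfigs]
  rw [this]
  exact isCompact_univ_pi fun _ => (Set.finite_Ico _ _).isCompact

theorem stableConfigs_subset_boundedConfigs (h : LaurentPoly d) :
    stableConfigs h ⊆ boundedConfigs d := fun v hv =>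
  ⟨h.coeff 0, fun n => by rw [abs_of_nonneg (hv n).1]; exact (hv n).2.le⟩

theorem isCompact_recurrentConfigs (h : LaurentPoly d) : IsCompact (recurrentConfigs h) := by
  have : recurrentConfigs h = stableConfigs h ∩ ⋂ (E : Finset (Fin d → ℤ)) (_ : E.Nonempty),
      ⋃ i ∈ E, {v | inflow h E i ≤ v i} := by
    ext v; simp [recurrentConfigs]
  rw [this]
  refine (isCompact_stableConfigs h).inter_right ?_
  refine isClosed_iInter fun E => isClosed_iInter fun _ => E.finite_toSet.isClosed_biUnion ?_
  exact fun i _ => isClosed_le continuous_const (continuous_apply i)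

theorem shift_mem_recurrentConfigs {h : LaurentPoly d} {v : (Fin d → ℤ) → ℤ}
    (hv : v ∈ recurrentConfigs h) (m : Fin d → ℤ) : shift m v ∈ recurrentConfigs h := by
  rw [mem_recurrentConfigs_iff] at hv ⊢
  refine ⟨fun i => hv.1 _, fun E hE => ?_⟩
  obtain ⟨i, hi, hle⟩ := hv.2 (E.map (addLeftEmbedding m)) (hE.map)
  obtain ⟨k, hk, rfl⟩ := Finset.mem_map.1 hi
  refine ⟨k, hk, ?_⟩
  simpa [shift, toppling] using hle

theorem xiBar_shift (h : LaurentPoly d) (m : Fin d → ℤ) (v : (Fin d → ℤ) → ℤ) :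
    xiBar h (shift m v) = shift m (xiBar h v) := by
  funext n
  simp [xiBar, conv, shift, add_sub_assoc]

theorem xi_shift (h : LaurentPoly d) (m : Fin d → ℤ) (v : (Fin d → ℤ) → ℤ) :
    xi h (shift m v) = shift m (xi h v) := by
  funext n
  simp only [xi, xiBar_shift, shift]

theorem shift_mem_boundedConfigs {v : (Fin d → ℤ) → ℤ} (hv : v ∈ boundedConfigs d)
    (m : Fin d → ℤ) : shift m v ∈ boundedConfigs d :=
  hv.imp fun _ hC n => hC (m + n)

theorem shift_mem_multiplesModel {h g : LaurentPoly d} {v : (Fin d → ℤ) → ℤ}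
    (hv : v ∈ multiplesModel h g) (m : Fin d → ℤ) : shift m v ∈ multiplesModel h g := by
  refine ⟨shift_mem_recurrentConfigs hv.1 m, shift_mem_boundedConfigs hv.2.1 m, ?_⟩
  rw [xi_shift, hv.2.2]
  rfl

/-- On stable configurations the series is dominated by `|w_j| h_0`, so it converges uniformly. -/
theorem continuousOn_xi {g : LaurentPoly d} (hg : ∃ w, IsHomoclinicPoint g w)
    (h : LaurentPoly d) : ContinuousOn (xi g) (stableConfigs h) := by
  refine continuousOn_pi.2 fun n => ?_
  refine (AddCircle.continuous_mk' 1).comp_continuousOn ?_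
  refine continuousOn_tsum (u := fun j => |homoclinicPoint g j| * h.coeff 0) (fun j => ?_)
    ((isHomoclinicPoint_homoclinicPoint hg).1.mul_right _) fun j v hv => ?_
  · have : Continuous fun v : (Fin d → ℤ) → ℤ => (v (n - j) : ℝ) :=
      (continuous_of_discreteTopology (f := fun k : ℤ => (k : ℝ))).comp (continuous_apply _)
    exact (continuous_const.mul this).continuousOn
  · rw [Real.norm_eq_abs, abs_mul]
    refine mul_le_mul_of_nonneg_left ?_ (abs_nonneg _)
    have h1 : |(v (n - j) : ℝ)| = v (n - j) := abs_of_nonneg (by exact_mod_cast (hv (n - j)).1)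
    have h2 : (v (n - j) : ℝ) ≤ h.coeff 0 := by exact_mod_cast (hv (n - j)).2.le
    exact h1.trans_le h2

theorem multiplesModel_subset_stableConfigs (h g : LaurentPoly d) :
    multiplesModel h g ⊆ stableConfigs h := fun _ hv => hv.1.1

theorem isCompact_multiplesModel {h g : LaurentPoly d} (hg : ∃ w, IsHomoclinicPoint g w) :
    IsCompact (multiplesModel h g) := by
  have : multiplesModel h g = recurrentConfigs h ∩ (stableConfigs h ∩ xi g ⁻¹' {0}) := by
    ext v
    constructor
    · rintro ⟨hv, -, hx⟩
      exact ⟨hv, hv.1, hx⟩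
    · rintro ⟨hv, hs, hx⟩
      exact ⟨hv, stableConfigs_subset_boundedConfigs h hs, hx⟩
  rw [this]
  exact (isCompact_recurrentConfigs h).inter_right <|
    (continuousOn_xi hg h).preimage_isClosed_of_isClosed (isCompact_stableConfigs h).isClosed
      isClosed_singleton

theorem exists_intCast_of_coe_eq_zero {x : (Fin d → ℤ) → ℝ}
    (hx : ∀ n, (x n : UnitAddCircle) = 0) : ∃ u : (Fin d → ℤ) → ℤ, x = fun n => (u n : ℝ) := by
  have : ∀ n, ∃ k : ℤ, (k : ℝ) = x n := fun n => by
    obtain ⟨k, hk⟩ := (AddCircle.coe_eq_zero_iff 1).1 (hx n)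
    exact ⟨k, by simpa using hk⟩
  choose u hu using this
  exact ⟨u, funext fun n => (hu n).symm⟩

theorem exists_mem_Ico_coe_eq (a : UnitAddCircle) :
    ∃ t ∈ Set.Ico (0 : ℝ) (0 + 1), (t : UnitAddCircle) = a := by
  have : a ∈ ((↑) : ℝ → UnitAddCircle) '' Set.Ico 0 (0 + 1) := by
    rw [AddCircle.coe_image_Ico_eq (1 : ℝ) 0]
    exact Set.mem_univ a
  exact this

theorem coe_intCast_unitAddCircle (k : ℤ) : ((k : ℝ) : UnitAddCircle) = 0 :=
  (AddCircle.coe_eq_zero_iff 1).2 ⟨k, by simp⟩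

theorem xiBar_polyMul {g : LaurentPoly d} (hg : ∃ w, IsHomoclinicPoint g w)
    {u : (Fin d → ℤ) → ℤ} (hu : u ∈ boundedConfigs d) :
    xiBar g (polyMul g u) = fun n => (u n : ℝ) := by
  rw [xiBar, polyMul_eq_act, ← act_intCast]
  exact (isHomoclinicPoint_homoclinicPoint hg).conv_act (isBdd_intCast.2 hu)

/-- The kernel of `ξ_g` consists of the multiples of `g`. -/
theorem mem_kerXi_iff {g : LaurentPoly d} (hg : ∃ w, IsHomoclinicPoint g w)
    {v : (Fin d → ℤ) → ℤ} :
    v ∈ kerXi g ↔ ∃ u ∈ boundedConfigs d, v = polyMul g u := by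
  have hw := isHomoclinicPoint_homoclinicPoint hg
  constructor
  · rintro ⟨hb, hx⟩
    have hbR := isBdd_intCast.2 hb
    obtain ⟨u, hu⟩ := exists_intCast_of_coe_eq_zero fun n => congrFun hx n
    refine ⟨u, isBdd_intCast.1 (hu ▸ IsBdd.conv hw.1 hbR), ?_⟩
    have h1 : act ℝ g (xiBar g v) = fun n => (v n : ℝ) := hw.act_conv hbR
    rw [hu, act_intCast] at h1
    funext n
    rw [polyMul_eq_act]
    exact_mod_cast (congrFun h1 n).symm
  · rintro ⟨u, hu, rfl⟩
    refine ⟨?_, ?_⟩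
    · rw [polyMul_eq_act]
      exact IsBdd.intAct hu g
    · funext n
      rw [xi, xiBar_polyMul hg hu]
      exact coe_intCast_unitAddCircle _

theorem coe_act {f : LaurentPoly d} (x : (Fin d → ℤ) → ℝ) (n : Fin d → ℤ) :
    ((act ℝ f x n : ℝ) : UnitAddCircle) = act UnitAddCircle f (fun k => (x k : UnitAddCircle)) n := by
  rw [act_apply, act_apply]
  exact (map_sum (QuotientAddGroup.mk' (AddSubgroup.zmultiples (1 : ℝ))) _ _)

/-- `ξ_h` maps the recurrent multiples of `g` onto `X_{f̃}` when `h = f g`. -/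
theorem image_xi_multiplesModel {f g : LaurentPoly d} (hh : IsSandpilePoly (f * g)) :
    xi (f * g) '' multiplesModel (f * g) g = algebraicModel (tilde f) := by
  have hex := hh.exists_isHomoclinicPoint
  have hgex : ∃ w, IsHomoclinicPoint g w := ⟨_, hex.choose_spec.of_mul⟩
  have hw := isHomoclinicPoint_homoclinicPoint hex
  apply Set.Subset.antisymm
  · rintro _ ⟨v, ⟨hv, hk⟩, rfl⟩
    obtain ⟨u, hu, rfl⟩ := (mem_kerXi_iff hgex).1 hk
    have huR := isBdd_intCast.2 hu
    have key : act ℝ f (xiBar (f * g) (polyMul g u)) = fun n => (u n : ℝ) := by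
      rw [xiBar, polyMul_eq_act, ← act_intCast, ← conv_act hw.1 (huR.act g), ← act_mul_apply]
      exact hw.conv_act huR
    rw [mem_algebraicModel_tilde]
    funext n
    have := coe_act (f := f) (xiBar (f * g) (polyMul g u)) n
    rw [key, coe_intCast_unitAddCircle] at this
    exact this.symm
  · intro x hx
    rw [mem_algebraicModel_tilde] at hx
    obtain ⟨y, hy, hyb⟩ : ∃ y : (Fin d → ℤ) → ℝ, (∀ n, (y n : UnitAddCircle) = x n) ∧ IsBdd y := by
      choose y hy hyx using fun n => exists_mem_Ico_coe_eq (x n)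
      exact ⟨y, hyx, 1, fun n => by
        have := hy n
        rw [abs_of_nonneg this.1]
        linarith [this.2]⟩
    have hfy : ∀ n, ((act ℝ f y n : ℝ) : UnitAddCircle) = 0 := fun n => by
      rw [coe_act, funext hy, hx, Pi.zero_apply]
    obtain ⟨u, hu⟩ := exists_intCast_of_coe_eq_zero hfy
    have hub : u ∈ boundedConfigs d := isBdd_intCast.1 (hu ▸ hyb.act f)
    obtain ⟨z, hz, hrec⟩ := exists_add_act_mem_recurrentConfigs hh (IsBdd.intAct hub g)
    have heq : act ℤ g u + act ℤ (f * g) z = polyMul g (u + act ℤ f z) := by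
      rw [polyMul_eq_act, map_add, mul_comm, act_mul_apply]
    have hbd : u + act ℤ f z ∈ boundedConfigs d := by
      obtain ⟨C, hC⟩ := hub
      obtain ⟨D, hD⟩ := IsBdd.intAct hz f
      exact ⟨C + D, fun n => (abs_add_le _ _).trans (add_le_add (hC n) (hD n))⟩
    refine ⟨_, ⟨hrec, (mem_kerXi_iff hgex).2 ⟨_, hbd, heq⟩⟩, ?_⟩
    have hzR := isBdd_intCast.2 hz
    -- `g · u + h · z = h · (y + z)` over the reals, so `w^h` returns `y + z`, which is `x` modulo
    -- 1.
    have hcast : (fun n => (((act ℤ g u + act ℤ (f * g) z) n : ℤ) : ℝ)) =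
        act ℝ (f * g) y + act ℝ (f * g) fun n => (z n : ℝ) := by
      rw [act_intCast, mul_comm f g, act_mul_apply g f y, hu, act_intCast]
      funext n
      simp
    funext n
    rw [xi, xiBar, hcast, conv_add hw.1 (hyb.act _) (hzR.act _), hw.conv_act hyb,
      hw.conv_act hzR, Pi.add_apply, AddCircle.coe_add, coe_intCast_unitAddCircle, add_zero, hy]

/-! ### Separated sets and factor maps -/

theorem card_le_maxSeparated {X : Type*} {T : (Fin d → ℤ) → X → X} {F : Set X}
    {E : Finset (Fin d → ℤ)} {U : Set (X × X)} {Z : Finset X} (hZ : (Z : Set X) ⊆ F)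
    (hsep : IsSeparatedIn T E U (Z : Set X)) : (Z.card : ℕ∞) ≤ maxSeparated T F E U :=
  le_iSup₂_of_le (f := fun (Z : Finset X) (_ : (Z : Set X) ⊆ F ∧ IsSeparatedIn T E U (Z : Set X)) =>
    (Z.card : ℕ∞)) Z ⟨hZ, hsep⟩ le_rfl

theorem maxSeparated_image_le {X Y : Type*} {S : (Fin d → ℤ) → Y → Y} {T : (Fin d → ℤ) → X → X}
    {W : Set Y} {φ : Y → X} (hW : ∀ m, Set.MapsTo (S m) W W)
    (hφ : ∀ m, ∀ v ∈ W, φ (S m v) = T m (φ v)) {U : Set (X × X)} {V : Set (Y × Y)}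
    (hVU : ∀ x ∈ W, ∀ y ∈ W, (x, y) ∈ V → (φ x, φ y) ∈ U) (E : Finset (Fin d → ℤ)) :
    maxSeparated T (φ '' W) E U ≤ maxSeparated S W E V := by
  classical
  refine iSup₂_le fun Z hZ => ?_
  obtain ⟨hZF, hsep⟩ := hZ
  rcases Z.eq_empty_or_nonempty with rfl | ⟨z₀, hz₀⟩
  · simp
  have : Nonempty Y := ⟨(hZF hz₀).choose⟩
  have hsec : ∀ z ∈ φ '' W, ∃ y ∈ W, φ y = z := fun z hz => hz
  choose! s hsW hs using hsec
  have hinj : Set.InjOn s Z := fun a ha b hb hab => by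
    rw [← hs a (hZF ha), hab, hs b (hZF hb)]
  rw [← Finset.card_image_of_injOn hinj]
  refine card_le_maxSeparated ?_ ?_
  · rw [Finset.coe_image]
    rintro _ ⟨z, hz, rfl⟩
    exact hsW z (hZF hz)
  · rw [Finset.coe_image]
    rintro _ ⟨z, hz, rfl⟩ _ ⟨z', hz', rfl⟩ hne
    obtain ⟨k, hk, hkU⟩ := hsep hz hz' fun h => hne (h ▸ rfl)
    refine ⟨k, hk, fun hV => hkU ?_⟩
    have hw := hsW z (hZF hz)
    have hw' := hsW z' (hZF hz')
    have := hVU _ (hW k hw) _ (hW k hw') hV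
    rwa [hφ k _ hw, hφ k _ hw', hs z (hZF hz), hs z' (hZF hz')] at this

theorem topEntropy_image_le {X Y : Type*} [UniformSpace X] [UniformSpace Y]
    {S : (Fin d → ℤ) → Y → Y} {T : (Fin d → ℤ) → X → X} {W : Set Y} {φ : Y → X}
    (hW : ∀ m, Set.MapsTo (S m) W W) (hφ : ∀ m, ∀ v ∈ W, φ (S m v) = T m (φ v))
    (hc : UniformContinuousOn φ W) : topEntropy T (φ '' W) ≤ topEntropy S W := by
  refine iSup₂_le fun U hU => ?_
  -- Uniform continuity on `W` gives an entourage that controls only pairs in `W`. This suffices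
  -- because `W` is invariant.
  have := hc hU
  rw [Filter.mem_map, Filter.mem_inf_principal] at this
  refine le_iSup₂_of_le (f := fun V (_ : V ∈ 𝓤 Y) => Filter.limsup (fun n : ℕ =>
    ENNReal.log (maxSeparated S W (box d n) V : ENNReal) / ((box d n).card : EReal))
    Filter.atTop) _ this ?_
  refine Filter.limsup_le_limsup (Filter.Eventually.of_forall fun n => ?_)
  refine EReal.div_le_div_right_of_nonneg (by positivity) (ENNReal.log_monotone ?_)
  exact ENat.toENNReal_mono (maxSeparated_image_le hW hφ
    (V := {p | p ∈ W ×ˢ W → (φ p.1, φ p.2) ∈ U}) (fun x hx y hy h => h ⟨hx, hy⟩) _)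

/-- A separated set of maximal cardinality is spanning, since a point far from all of it could be
added. Finiteness of the supremum ensures that the maximum is attained. -/
theorem exists_spanning_of_maxSeparated_ne_top {X : Type*} {T : (Fin d → ℤ) → X → X} {F : Set X}
    {E : Finset (Fin d → ℤ)} {U : Set (X × X)} (hrefl : ∀ x, (x, x) ∈ U)
    (hsymm : ∀ x y, (x, y) ∈ U → (y, x) ∈ U) (h : maxSeparated T F E U ≠ ⊤) :
    ∃ Y : Finset X, (Y : Set X) ⊆ F ∧ (Y.card : ℕ∞) ≤ maxSeparated T F E U ∧
      ∀ x ∈ F, ∃ y ∈ Y, ∀ k ∈ E, (T k x, T k y) ∈ U := by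
  classical
  obtain ⟨N, hN⟩ := ENat.ne_top_iff_exists.1 h
  set P : ℕ → Prop := fun m =>
    ∃ Z : Finset X, ((Z : Set X) ⊆ F ∧ IsSeparatedIn T E U (Z : Set X)) ∧ Z.card = m with hP
  have hbound : ∀ Z : Finset X, (Z : Set X) ⊆ F → IsSeparatedIn T E U (Z : Set X) →
      Z.card ≤ N := fun Z h1 h2 => by
    have := card_le_maxSeparated h1 h2
    rw [← hN] at this
    exact_mod_cast this
  obtain ⟨Y, ⟨hYF, hYsep⟩, hcard⟩ : P (Nat.findGreatest P N) :=
    Nat.findGreatest_spec (m := 0) (Nat.zero_le _) ⟨∅, ⟨by simp, by simp [IsSeparatedIn]⟩, rfl⟩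
  refine ⟨Y, hYF, card_le_maxSeparated hYF hYsep, fun x hx => ?_⟩
  by_contra! hcon
  have hxY : x ∉ Y := fun hxY => by
    obtain ⟨k, -, hk⟩ := hcon x hxY
    exact hk (hrefl _)
  have hins : IsSeparatedIn T E U (insert x Y : Finset X) := by
    rw [IsSeparatedIn, Finset.coe_insert]
    refine Set.Pairwise.insert hYsep fun y hy _ => ⟨hcon y hy, ?_⟩
    obtain ⟨k, hk, hkU⟩ := hcon y hy
    exact ⟨k, hk, fun h => hkU (hsymm _ _ h)⟩
  have hinsF : ((insert x Y : Finset X) : Set X) ⊆ F := by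
    rw [Finset.coe_insert]
    exact Set.insert_subset hx hYF
  have hc : (insert x Y : Finset X).card = Y.card + 1 := Finset.card_insert_of_notMem hxY
  exact Nat.findGreatest_is_greatest (P := P) (n := N) (k := Y.card + 1) (by omega)
    (hc ▸ hbound _ hinsF hins) ⟨_, ⟨hinsF, hins⟩, hc⟩

/-! ### Boxes -/

theorem mem_box {n : ℕ} {k : Fin d → ℤ} : k ∈ box d n ↔ ∀ i, |k i| ≤ n := by
  simp [box, abs_le]

theorem card_box (d n : ℕ) : (box d n).card = (2 * n + 1) ^ d := by
  rw [box, Fintype.card_piFinset_const, Int.card_Icc]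
  congr 1
  omega

theorem box_mono {m n : ℕ} (h : m ≤ n) : box d m ⊆ box d n := fun k hk =>
  mem_box.2 fun i => (mem_box.1 hk i).trans (by exact_mod_cast h)

theorem sub_mem_box {m n : ℕ} {k j : Fin d → ℤ} (hk : k ∈ box d m) (hj : j ∈ box d n) :
    k - j ∈ box d (m + n) := by
  rw [mem_box] at *
  intro i
  push_cast
  exact (abs_sub _ _).trans (add_le_add (hk i) (hj i))

theorem add_mem_box {m n : ℕ} {k j : Fin d → ℤ} (hk : k ∈ box d m) (hj : j ∈ box d n) :
    k + j ∈ box d (m + n) := by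
  rw [mem_box] at *
  intro i
  push_cast
  exact (abs_add_le _ _).trans (add_le_add (hk i) (hj i))

theorem exists_subset_box (S : Finset (Fin d → ℤ)) : ∃ R, S ⊆ box d R := by
  refine ⟨S.sup fun j => Finset.univ.sup fun i => (j i).natAbs, fun j hj => mem_box.2 fun i => ?_⟩
  have h1 : (j i).natAbs ≤ Finset.univ.sup fun i => (j i).natAbs :=
    Finset.le_sup (f := fun i => (j i).natAbs) (Finset.mem_univ i)
  have h2 := Finset.le_sup (f := fun j : Fin d → ℤ => Finset.univ.sup fun i => (j i).natAbs) hj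
  rw [Int.abs_eq_natAbs]
  exact_mod_cast h1.trans h2

theorem tendsto_card_annulus_div (d r R : ℕ) : Filter.Tendsto
    (fun n : ℕ => ((box d (n + r) \ box d (n - R)).card : ℝ) / (box d n).card)
    Filter.atTop (𝓝 0) := by
  have hlin : ∀ a : ℝ, Filter.Tendsto (fun n : ℕ => (2 * (n : ℝ) + 1 + a) / (2 * n + 1))
      Filter.atTop (𝓝 1) := fun a => by
    have h1 : Filter.Tendsto (fun n : ℕ => 2 * (n : ℝ) + 1) Filter.atTop Filter.atTop :=
      Filter.tendsto_atTop_add_const_right _ _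
        (tendsto_natCast_atTop_atTop.const_mul_atTop two_pos)
    have h2 : Filter.Tendsto (fun n : ℕ => 1 + a / (2 * (n : ℝ) + 1)) Filter.atTop (𝓝 (1 + 0)) :=
      (h1.const_div_atTop a).const_add 1
    rw [add_zero] at h2
    refine h2.congr fun n => ?_
    have : (2 * (n : ℝ) + 1) ≠ 0 := by positivity
    field_simp
  have hlim := ((hlin (2 * r)).pow d).sub ((hlin (-(2 * R))).pow d)
  rw [sub_self] at hlim
  refine hlim.congr' ?_
  filter_upwards [Filter.eventually_ge_atTop R] with n hn
  rw [Finset.card_sdiff_of_subset (box_mono (by omega)),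
    Nat.cast_sub (Finset.card_le_card (box_mono (by omega))), sub_div]
  simp only [card_box]
  push_cast [Nat.cast_sub hn]
  rw [← div_pow, ← div_pow]
  congr 3 <;> ring

/-! ### Entourages -/

theorem exists_box_of_mem_uniformity {U : Set (((Fin d → ℤ) → ℤ) × ((Fin d → ℤ) → ℤ))}
    (hU : U ∈ 𝓤 ((Fin d → ℤ) → ℤ)) :
    ∃ r, ∀ x y : (Fin d → ℤ) → ℤ, (∀ k ∈ box d r, x k = y k) → (x, y) ∈ U := by
  rw [Pi.uniformity, Filter.mem_iInf] at hU
  obtain ⟨I, hI, V, hV, rfl⟩ := hU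
  obtain ⟨r, hr⟩ := exists_subset_box hI.toFinset
  refine ⟨r, fun x y hxy => Set.mem_iInter.2 fun i => ?_⟩
  obtain ⟨t, ht, htV⟩ := Filter.mem_comap.1 (hV i)
  refine htV ?_
  have : x i = y i := hxy i (hr (hI.mem_toFinset.2 i.2))
  simp only [Set.mem_preimage, this]
  exact refl_mem_uniformity ht

/-- Pairs of configurations on the circle whose values at the origin are `ε`-close. -/
def originEntourage (d : ℕ) (ε : ℝ) :
    Set (((Fin d → ℤ) → UnitAddCircle) × ((Fin d → ℤ) → UnitAddCircle)) :=
  {p | ‖p.1 0 - p.2 0‖ < ε}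

theorem originEntourage_mem_uniformity {ε : ℝ} (hε : 0 < ε) :
    originEntourage d ε ∈ 𝓤 ((Fin d → ℤ) → UnitAddCircle) := by
  have h := (Pi.uniformContinuous_proj (fun _ : Fin d → ℤ => UnitAddCircle) 0)
    (Metric.dist_mem_uniformity hε)
  rw [Filter.mem_map] at h
  refine Filter.mem_of_superset h fun p hp => ?_
  have : dist (p.1 0) (p.2 0) < ε := hp
  rwa [dist_eq_norm] at this

/-! ### Counting recurrent multiples -/

/-- Injectivity up to boundary data. Multiplying the approximate equality `w^h · (v - v') ≈ z` by
`h` gives an integer of absolute value less than 1, so `v - v' = h · z` on the inner box, which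
contains the support of `z`. Recurrence then forces `z = 0`. -/
theorem eq_on_box_of_recurrent {h : LaurentPoly d} (hh : IsSandpilePoly h)
    {v v' z : (Fin d → ℤ) → ℤ} (hv : v ∈ recurrentConfigs h) (hv' : v' ∈ recurrentConfigs h)
    {n R : ℕ} (hR : h.coeff.support ⊆ box d R) (hRn : R ≤ n)
    (hz : ∀ k, k ∉ box d (n - R) → z k = 0) {δ : ℝ}
    (hδ : (∑ j ∈ h.coeff.support, |(h.coeff j : ℝ)|) * δ < 1)
    (hclose : ∀ k ∈ box d n, |xiBar h v k - xiBar h v' k - z k| ≤ δ) :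
    ∀ k ∈ box d (n - R), v k = v' k := by
  have hw := isHomoclinicPoint_homoclinicPoint hh.exists_isHomoclinicPoint
  have hact : ∀ u ∈ recurrentConfigs h, act ℝ h (xiBar h u) = fun k => (u k : ℝ) := fun u hu =>
    hw.act_conv (isBdd_intCast.2 (stableConfigs_subset_boundedConfigs h hu.1))
  have key : ∀ i ∈ box d (n - R), v i - v' i = act ℤ h z i := by
    intro i hi
    have h1 : act ℝ h (xiBar h v - xiBar h v' - fun k => (z k : ℝ)) i =
        ((v i - v' i - act ℤ h z i : ℤ) : ℝ) := by
      rw [map_sub, map_sub, hact v hv, hact v' hv', act_intCast]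
      simp
    have h2 : |act ℝ h (xiBar h v - xiBar h v' - fun k => (z k : ℝ)) i| < 1 := by
      refine lt_of_le_of_lt ?_ hδ
      rw [act_apply, Finset.sum_mul]
      refine (Finset.abs_sum_le_sum_abs _ _).trans (Finset.sum_le_sum fun j hj => ?_)
      rw [zsmul_eq_mul, abs_mul]
      refine mul_le_mul_of_nonneg_left (hclose _ ?_) (abs_nonneg _)
      -- The margin `R` keeps every site read by `h` inside `Q_n`, where closeness is assumed.
      have := sub_mem_box hi (hR hj)
      rwa [Nat.sub_add_cancel hRn] at this
    rw [h1] at h2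
    have h3 : |v i - v' i - act ℤ h z i| < 1 := by exact_mod_cast h2
    have := Int.abs_lt_one_iff.1 h3
    omega
  have hz0 : z = 0 := by
    refine eq_zero_of_recurrent hh hv hv' ((box d (n - R)).finite_toSet.subset fun k hk => ?_)
      fun i hi => key i ?_
    · by_contra hkb
      exact hk (hz k hkb)
    · by_contra hkb
      exact hi (hz i hkb)
  intro k hk
  have := key k hk
  rw [hz0, map_zero, Pi.zero_apply] at this
  omega

theorem abs_sub_round_lt_of_norm_lt {a b ε : ℝ}
    (h : ‖(a : UnitAddCircle) - (b : UnitAddCircle)‖ < ε) : |a - b - round (a - b)| < ε := by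
  rwa [← AddCircle.coe_sub, UnitAddCircle.norm_eq] at h

/-- Up to a factor that is exponential in the size of an annulus, the recurrent multiples are
counted by the points of the image under `ξ_h`. -/
theorem exists_maxSeparated_le {h g : LaurentPoly d} (hh : IsSandpilePoly h)
    {X : Set ((Fin d → ℤ) → UnitAddCircle)} (hX : Set.MapsTo (xi h) (multiplesModel h g) X)
    {U : Set (((Fin d → ℤ) → ℤ) × ((Fin d → ℤ) → ℤ))} (hU : U ∈ 𝓤 ((Fin d → ℤ) → ℤ)) :
    ∃ V ∈ 𝓤 ((Fin d → ℤ) → UnitAddCircle), ∃ K r R : ℕ, 0 < K ∧ ∀ n ≥ R,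
      maxSeparated shift (multiplesModel h g) (box d n) U ≤
        (K : ℕ∞) ^ (box d (n + r) \ box d (n - R)).card * maxSeparated shift X (box d n) V := by
  classical
  obtain ⟨r, hr⟩ := exists_box_of_mem_uniformity hU
  obtain ⟨R, hR⟩ := exists_subset_box h.coeff.support
  have hw := isHomoclinicPoint_homoclinicPoint hh.exists_isHomoclinicPoint
  set H : ℝ := ∑ j ∈ h.coeff.support, |(h.coeff j : ℝ)| with hHdef
  have hH : 0 ≤ H := Finset.sum_nonneg fun _ _ => abs_nonneg _
  -- Two configurations are compared through one common centre, so the error doubles: `2 ε H < 1` is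
  -- what `eq_on_box_of_recurrent` requires.
  set ε : ℝ := 1 / (2 * H + 2) with hεdef
  have hε : 0 < ε := by positivity
  have hHε : H * (2 * ε) < 1 := by
    rw [hεdef, mul_one_div, mul_div, div_lt_one (by positivity)]
    linarith
  have h0 := hh.coeff_zero_pos
  have hbdd : ∃ B : ℤ, ∀ v ∈ multiplesModel h g, ∀ k, |xiBar h v k| ≤ B := by
    refine ⟨⌈(∑' j, |homoclinicPoint h j|) * h.coeff 0⌉, fun v hv k =>
      (abs_conv_le hw.1 (fun i => ?_) k).trans (Int.le_ceil _)⟩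
    have h1 := multiplesModel_subset_stableConfigs h g hv i
    rw [abs_of_nonneg (by exact_mod_cast h1.1)]
    exact_mod_cast h1.2.le
  obtain ⟨B, hB⟩ := hbdd
  -- Boundary data at one site: the value of `v` and the rounded integer. The latter is at most `B +
  -- 1 + 1/2` in absolute value, from the bound on `w^h · v`, the lift in `[0, 1)` and the rounding
  -- error.
  set L : Finset (ℤ × ℤ) := Finset.Ico 0 (h.coeff 0) ×ˢ Finset.Icc (-(B + 2)) (B + 2) with hLdef
  refine ⟨_, originEntourage_mem_uniformity hε, max 1 L.card, r, R, by omega, fun n hn => ?_⟩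
  by_cases htop : maxSeparated shift X (box d n) (originEntourage d ε) = ⊤
  · rw [htop, ENat.mul_top (pow_ne_zero _ (by norm_cast; omega))]
    exact le_top
  obtain ⟨Y, hYX, hYcard, hY⟩ := exists_spanning_of_maxSeparated_ne_top
    (fun x => by simpa [originEntourage] using hε)
    (fun x y hxy => by
      simp only [originEntourage, Set.mem_ofPred_eq] at hxy ⊢
      rwa [norm_sub_rev]) htop
  choose lift hlift_mem hlift using exists_mem_Ico_coe_eq
  choose! y hyY hyclose using fun v (hv : v ∈ multiplesModel h g) => hY _ (hX hv)
  -- The lift depends only on the centre `y v`, so it cancels between configurations with the same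
  -- centre, leaving `ρ v - ρ v'` as the integer approximation to the difference.
  set ρ : ((Fin d → ℤ) → ℤ) → (Fin d → ℤ) → ℤ := fun v k =>
    round (xiBar h v k - lift (y v k)) with hρ
  have hρclose : ∀ v ∈ multiplesModel h g, ∀ k ∈ box d n,
      |xiBar h v k - lift (y v k) - ρ v k| < ε := fun v hv k hk => by
    refine abs_sub_round_lt_of_norm_lt ?_
    have := hyclose v hv k hk
    simp only [originEntourage, Set.mem_ofPred_eq, shift, add_zero] at this
    rwa [hlift]
  -- The outer radius `n + r` covers all coordinates that `U` sees after shifts by `Q_n`. Inside `n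
  -- - R` the configuration is determined by the data on `A` and the centre.
  set A := box d (n + r) \ box d (n - R) with hA
  refine le_trans ?_ (mul_le_mul_right hYcard _)
  refine le_trans (b := ((L.card ^ A.card * Y.card : ℕ) : ℕ∞)) (iSup₂_le fun Z hZ => ?_) ?_
  · obtain ⟨hZW, hsep⟩ := hZ
    have hcard : (Fintype.piFinset fun _ : A => L).card = L.card ^ A.card := by
      simp [Fintype.card_piFinset]
    rw [← hcard, ← Finset.card_product]
    refine Nat.cast_le.2 (Finset.card_le_card_of_injOn
      (fun v => (fun k => (v k, ρ v k), y v)) ?_ ?_)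
    · intro v hv
      have hvW := hZW hv
      refine Finset.mem_coe.2 (Finset.mem_product.2 ⟨Fintype.mem_piFinset.2 fun k => ?_, hyY v hvW⟩)
      refine Finset.mem_product.2 ⟨Finset.mem_Ico.2 (multiplesModel_subset_stableConfigs h g hvW k),
        Finset.mem_Icc.2 (abs_le.1 ?_)⟩
      have h1 := abs_le.1 (hB v hvW k)
      have h2 := hlift_mem (y v k)
      have h3 := abs_le.1 (abs_sub_round (xiBar h v k - lift (y v k)))
      have h4 : |((ρ v k : ℤ) : ℝ)| ≤ B + 2 := by
        rw [abs_le]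
        simp only [hρ]
        constructor <;> linarith [h1.1, h1.2, h2.1, h2.2, h3.1, h3.2]
      exact_mod_cast h4
    · intro v hv v' hv' heq
      by_contra hne
      obtain ⟨k, hk, hkU⟩ := hsep hv hv' hne
      refine hkU (hr _ _ fun j hj => ?_)
      have hvW := hZW hv
      have hvW' := hZW hv'
      have hy : y v = y v' := congrArg Prod.snd heq
      have hann : ∀ i ∈ A, v i = v' i ∧ ρ v i = ρ v' i := fun i hi => by
        have := congrFun (congrArg Prod.fst heq) ⟨i, hi⟩
        exact Prod.mk.inj this
      -- The difference of the roundings is cut off outside `Q_n`. Agreement on `A` makes the cutoff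
      -- vanish outside `Q_{n-R}`.
      have hin := eq_on_box_of_recurrent hh hvW.1 hvW'.1 hR hn
        (z := fun i => if i ∈ box d n then ρ v i - ρ v' i else 0) (δ := 2 * ε)
        (fun i hi => by
          split_ifs with hin
          · have := (hann i (Finset.mem_sdiff.2 ⟨box_mono (Nat.le_add_right _ _) hin, hi⟩)).2
            omega
          · rfl) hHε (fun i hi => by
          have h1 := abs_lt.1 (hρclose v hvW i hi)
          have h2 := abs_lt.1 (hρclose v' hvW' i hi)
          rw [hy] at h1
          rw [if_pos hi, abs_le]
          push_cast
          constructor <;> linarith [h1.1, h1.2, h2.1, h2.2])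
      have hkj := add_mem_box hk hj
      simp only [shift]
      by_cases hb : k + j ∈ box d (n - R)
      · exact hin _ hb
      · exact (hann _ (Finset.mem_sdiff.2 ⟨hkj, hb⟩)).1
  · push_cast
    gcongr
    exact_mod_cast le_max_right _ _

/-- After taking logarithms and dividing by `|Q_n|`, the factor `K ^ |A|` contributes `log K` times
the relative size of the annulus, which tends to 0. -/
theorem topEntropy_multiplesModel_le {h g : LaurentPoly d} (hh : IsSandpilePoly h)
    {X : Set ((Fin d → ℤ) → UnitAddCircle)} (hX : Set.MapsTo (xi h) (multiplesModel h g) X) :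
    topEntropy (shift (d := d) (A := ℤ)) (multiplesModel h g) ≤
      topEntropy (shift (A := UnitAddCircle)) X := by
  refine iSup₂_le fun U hU => ?_
  obtain ⟨V, hV, K, r, R, hK, hle⟩ := exists_maxSeparated_le hh hX hU
  refine le_iSup₂_of_le (f := fun V (_ : V ∈ 𝓤 ((Fin d → ℤ) → UnitAddCircle)) =>
    Filter.limsup (fun n : ℕ => ENNReal.log (maxSeparated shift X (box d n) V : ENNReal) /
      ((box d n).card : EReal)) Filter.atTop) V hV ?_
  set t : ℕ → EReal := fun n =>
    ((((box d (n + r) \ box d (n - R)).card : ℝ) / (box d n).card * Real.log K : ℝ) : EReal) with ht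
  have ht0 : Filter.limsup t Filter.atTop = 0 := by
    have := (tendsto_card_annulus_div d r R).mul_const (Real.log K)
    rw [zero_mul] at this
    exact ((continuous_coe_real_ereal.tendsto 0).comp this).limsup_eq
  set s : ℕ → EReal := fun n => ENNReal.log (maxSeparated shift X (box d n) V : ENNReal) /
      ((box d n).card : EReal) with hs
  have hsum : Filter.limsup (t + s) Filter.atTop ≤ Filter.limsup s Filter.atTop := by
    refine (EReal.limsup_add_le ?_ ?_).trans ?_
    · rw [ht0]; exact Or.inl EReal.zero_ne_bot
    · rw [ht0]; exact Or.inl EReal.zero_ne_top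
    · rw [ht0, zero_add]
  refine le_trans (Filter.limsup_le_limsup ?_) hsum
  filter_upwards [Filter.eventually_ge_atTop R] with n hn
  have h1 := ENNReal.log_monotone (ENat.toENNReal_mono (hle n hn))
  rw [ENat.toENNReal_mul, ENat.toENNReal_pow, ENNReal.log_mul_add, ENNReal.log_pow] at h1
  refine (EReal.div_le_div_right_of_nonneg (by positivity) h1).trans_eq ?_
  rw [EReal.add_div_of_nonneg_right (by positivity), Pi.add_apply, hs, ht]
  congr 1
  have hlog : ENNReal.log ((K : ℕ∞) : ENNReal) = ((Real.log K : ℝ) : EReal) := by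
    rw [ENat.toENNReal_coe, ENNReal.log_pos_real (by exact_mod_cast hK.ne') (by simp)]
    simp
  rw [hlog]
  simp only [← EReal.coe_coe_eq_natCast, ← EReal.coe_mul, ← EReal.coe_div]
  rw [mul_div_right_comm]

theorem isEqualEntropyCover_multiplesModel {f g : LaurentPoly d} (hh : IsSandpilePoly (f * g)) :
    IsEqualEntropyCover (multiplesModel (f * g) g) (shift (A := UnitAddCircle))
      (algebraicModel (tilde f)) (xi (f * g)) := by
  have hex := hh.exists_isHomoclinicPoint
  have hgex : ∃ w, IsHomoclinicPoint g w := ⟨_, hex.choose_spec.of_mul⟩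
  have himage := image_xi_multiplesModel hh
  have hcpt := isCompact_multiplesModel (h := f * g) hgex
  have hcont : ContinuousOn (xi (f * g)) (multiplesModel (f * g) g) :=
    (continuousOn_xi hex (f * g)).mono (multiplesModel_subset_stableConfigs _ _)
  exact
    { subshift :=
        { bounded := fun v hv => hv.2.1
          isCompact := hcpt
          invariant := fun m v hv => shift_mem_multiplesModel hv m }
      system := isCompactSystem_algebraicModel f
      continuousOn := hcont
      image_eq := himage
      equivariant := fun m v _ => xi_shift _ m v
      entropy_eq := by
        refine le_antisymm (topEntropy_multiplesModel_le hh ?_) ?_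
        · exact fun v hv => himage ▸ Set.mem_image_of_mem _ hv
        · rw [← himage]
          exact topEntropy_image_le (fun m v hv => shift_mem_multiplesModel hv m)
            (fun m v _ => xi_shift _ m v) (hcpt.uniformContinuousOn_of_continuous hcont) }

end Sandpile

end

open Sandpile
theorem mainTheorem2 (d : ℕ) (hd : 1 ≤ d) (f g h : LaurentPoly d) (hfg : h = f * g)
    (hh : IsSandpilePoly h) (hrel : IsRelPrime f g) :
    (∃! w, IsHomoclinicPoint g w) ∧ (∃! w, IsHomoclinicPoint h w) ∧
    multiplesModel h g =
      {v | v ∈ recurrentConfigs h ∧ ∃ u ∈ boundedConfigs d, v = polyMul g u} ∧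
    IsEqualEntropyCover (multiplesModel h g) (shift (A := UnitAddCircle))
      (algebraicModel (tilde f)) (xi h) := by
  subst hfg
  obtain ⟨w, hw⟩ := hh.exists_isHomoclinicPoint
  have hg := hw.of_mul
  refine ⟨⟨_, hg, fun _ hw' => hg.unique hw'⟩, ⟨w, hw, fun _ hw' => hw.unique hw'⟩, ?_,
    isEqualEntropyCover_multiplesModel hh⟩
  ext v
  exact and_congr_right fun _ => mem_kerXi_iff ⟨_, hg⟩
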